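/- Let $X$ be a real Banach space with a normalized unconditional Schauder basis $\{x_k\}_{k=1}^\infty$ (so $\|x_k\|_X=1$, and every element of $X$ is the sum of a unique, unconditionally convergent series $\sum_k c_k x_k$). A Radon measure $\mu$ on a Banach space $Z$ is called convex (log-concave) if $$\mu(\lambda A+(1-\lambda)B)\ \ge\ \mu(A)^{\lambda}\,\mu(B)^{1-\lambda}$$ for all $0\le\lambda\le1$ and all nonempty Borel sets $A,B\subseteq Z$ (the measure of the left-hand set being taken in the completion of $\mu$). Theorem. Let $\{\xi_k\}_{k=1}^\infty$ be independent real random variables on a probability space $(\Omega,\mathcal F,\mathbb P)$, each of whose laws is a convex probability measure on $\mathbb R$, let $\{\gamma_k\}_{k=1}^\infty$ be a sequence of real numbers, and suppose that $$\sum_{k=1}^\infty \mathbb E\,\min\bigl(|\gamma_k\xi_k|,\,1\bigr)<\infty .$$ Then: (i) the series $u=\sum_{k=1}^\infty \gamma_k\xi_k x_k$ converges (unconditionally) in $X$ almost surely, so that $u$ is, after setting it to $0$ on the null set where the series diverges, an $X$-valued random variable up to a null set, with law a Borel probability measure $\mu$ on $X$; in particular $\|u\|_X<\infty$ a.s.;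 (ii) $\mu$ is a convex (in particular Radon) probability measure on $X$; (iii) there is an $\epsilon>0$ such that $\int_X \exp(\epsilon\|u\|_X)\,d\mu(u)<\infty$. -/

import Mathlib

open MeasureTheory ProbabilityTheory

section ConvexMeasures

open scoped Pointwise

/-- A convex (log-concave) measure on a normed space `X` with its Borel σ-algebra: a Radon measure
such that `μ (l A + (1 - l) B) ≥ μ(A) ^ l * μ(B) ^ (1 - l)` for all `0 ≤ l ≤ 1` and all Borel sets
`A`, `B`. The sets are nonempty, so that the endpoints `l = 0, 1` make sense (with `0 ^ 0 = 1`);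
for `0 < l < 1` an empty set gives a trivial inequality.
The sum `l A + (1 - l) B` of Borel sets need not be Borel. On a separable Banach space it is
analytic, hence measurable for the completion of a finite `μ`, and the value `μ (l A + (1 - l) B)`
is the one that the completion gives. -/
structure IsConvexMeasure {X : Type*} [NormedAddCommGroup X] [NormedSpace ℝ X]
    [MeasurableSpace X] [BorelSpace X] (μ : Measure X) : Prop where
  locallyFinite : IsLocallyFiniteMeasure μ
  innerRegular : μ.InnerRegular
  convex : ∀ l : ℝ, 0 ≤ l → l ≤ 1 → ∀ A B : Set X, MeasurableSet A → MeasurableSet B →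
    A.Nonempty → B.Nonempty → μ A ^ l * μ B ^ (1 - l) ≤ μ (l • A + (1 - l) • B)

end ConvexMeasures

/-- The random series `u = ∑ₖ γₖ ξₖ xₖ`; it has its intended value at each `ω` at which
the series converges (unconditionally), and the value `0` elsewhere. -/
noncomputable def randomSeries {Ω X : Type*} [NormedAddCommGroup X] [NormedSpace ℝ X]
    (x : ℕ → X) (γ : ℕ → ℝ) (ξ : ℕ → Ω → ℝ) (ω : Ω) : X :=
  ∑' k, (γ k * ξ k ω) • x k

open scoped Pointwise ENNReal
open Filter Topology

/-! By Tonelli, `∑ min(|γₖ ξₖ|, 1)` is finite almost surely, so its terms tend to zero, the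
truncation is inactive for all but finitely many `k`, and `∑ |γₖ ξₖ|` is finite. The basis is
normalized, so the series converges absolutely.

The partial sums are linear images of independent log-concave variables. Their laws are log-concave
by `IsLogConcave.prod` and `IsLogConcave.map`. The product case is a Prékopa-Leindler inequality
over a log-concave measure, reduced by the layer-cake formula to the inequality on the line, which
rests on one-dimensional Brunn-Minkowski. `IsLogConcave.map_of_tendsto_ae` carries log-concavity to
the almost sure limit.

The exponential moment holds for every log-concave probability measure: Borell's argument
(`IsLogConcave.measureReal_norm_gt_le`) makes the tails of the norm decay geometrically. -/

/-! ### Brunn-Minkowski and Prékopa-Leindler on the line. -/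

/-- Weighted arithmetic-geometric mean inequality in `ℝ≥0∞`. -/
theorem ENNReal.rpow_mul_rpow_le_weighted_add {l : ℝ} (h0 : 0 < l) (h1 : l < 1) (a b : ℝ≥0∞) :
    a ^ l * b ^ (1 - l) ≤ ENNReal.ofReal l * a + ENNReal.ofReal (1 - l) * b := by
  have h1' : 0 < 1 - l := by linarith
  have hpq : (l⁻¹).HolderConjugate (1 - l)⁻¹ := by
    rw [Real.holderConjugate_iff]
    refine ⟨(one_lt_inv₀ h0).2 h1, ?_⟩
    simp
  refine (ENNReal.young_inequality (a ^ l) (b ^ (1 - l)) hpq).trans_eq ?_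
  rw [← ENNReal.rpow_mul, ← ENNReal.rpow_mul, mul_inv_cancel₀ h0.ne', mul_inv_cancel₀ h1'.ne',
    ENNReal.rpow_one, ENNReal.rpow_one, ENNReal.ofReal_inv_of_pos h0,
    ENNReal.ofReal_inv_of_pos h1', div_eq_mul_inv, div_eq_mul_inv, inv_inv, inv_inv,
    mul_comm a, mul_comm b]

/-- The translates `K + min L` and `max K + L` lie in `K + L` and meet in at most one point. -/
theorem IsCompact.volume_add_le_volume_add {K L : Set ℝ} (hK : IsCompact K) (hL : IsCompact L)
    (hK0 : K.Nonempty) (hL0 : L.Nonempty) : volume K + volume L ≤ volume (K + L) := by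
  obtain ⟨k, hk⟩ := hK.exists_isGreatest hK0
  obtain ⟨m, hm⟩ := hL.exists_isLeast hL0
  have hsub : (fun x => x + m) '' K ∪ (fun x => k + x) '' L ⊆ K + L := by
    rintro _ (⟨x, hx, rfl⟩ | ⟨x, hx, rfl⟩)
    · exact Set.add_mem_add hx hm.1
    · exact Set.add_mem_add hk.1 hx
  have hmeas : MeasurableSet ((fun x => k + x) '' L) :=
    (hL.image (by fun_prop)).measurableSet
  have hint : volume ((fun x => x + m) '' K ∩ (fun x => k + x) '' L) = 0 := by
    refine measure_mono_null (t := {k + m}) ?_ (by simp)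
    rintro _ ⟨⟨x, hx, rfl⟩, ⟨y, hy, hxy⟩⟩
    have := hk.2 hx
    have := hm.2 hy
    simp only at hxy
    rw [Set.mem_singleton_iff]
    linarith
  calc volume K + volume L
      = volume ((fun x => x + m) '' K) + volume ((fun x => k + x) '' L) := by
        rw [Set.image_add_right, Set.image_add_left, measure_preimage_add_right,
          measure_preimage_add]
    _ = volume ((fun x => x + m) '' K ∪ (fun x => k + x) '' L) := by
        rw [← measure_union_add_inter _ hmeas, hint, add_zero]
    _ ≤ _ := measure_mono hsub

theorem MeasurableSet.volume_le_iSup_isCompact_nonempty {A : Set ℝ} (hA : MeasurableSet A) :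
    volume A ≤ ⨆ K : {K : Set ℝ // K ⊆ A ∧ IsCompact K ∧ K.Nonempty}, volume (K : Set ℝ) := by
  refine le_of_forall_lt fun r hr => ?_
  obtain ⟨K, hKA, hK, hrK⟩ := hA.exists_lt_isCompact hr
  have hne : K.Nonempty := nonempty_of_measure_ne_zero (pos_of_gt hrK).ne'
  exact hrK.trans_le
    (le_iSup (fun K : {K : Set ℝ // K ⊆ A ∧ IsCompact K ∧ K.Nonempty} => volume (K : Set ℝ))
      ⟨K, hKA, hK, hne⟩)

/-- One-dimensional Brunn-Minkowski inequality. -/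
theorem MeasurableSet.volume_add_le_volume_add {A B : Set ℝ} (hA : MeasurableSet A)
    (hB : MeasurableSet B) (hA0 : A.Nonempty) (hB0 : B.Nonempty) :
    volume A + volume B ≤ volume (A + B) := by
  have ne : ∀ {A : Set ℝ}, A.Nonempty →
      Nonempty {K : Set ℝ // K ⊆ A ∧ IsCompact K ∧ K.Nonempty} := by
    rintro A ⟨a, ha⟩
    exact ⟨{a}, by simpa using ha, isCompact_singleton, Set.singleton_nonempty a⟩
  have := ne hA0
  have := ne hB0
  refine (add_le_add hA.volume_le_iSup_isCompact_nonempty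
    hB.volume_le_iSup_isCompact_nonempty).trans (ENNReal.iSup_add_iSup_le ?_)
  rintro ⟨K, hKA, hK, hK0⟩ ⟨L, hLB, hL, hL0⟩
  exact (hK.volume_add_le_volume_add hL hK0 hL0).trans (measure_mono (Set.add_subset_add hKA hLB))

theorem MeasurableSet.volume_weighted_add_le {l : ℝ} (h0 : 0 < l) (h1 : l < 1) {A B : Set ℝ}
    (hA : MeasurableSet A) (hB : MeasurableSet B) (hA0 : A.Nonempty) (hB0 : B.Nonempty) :
    ENNReal.ofReal l * volume A + ENNReal.ofReal (1 - l) * volume B ≤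
      volume (l • A + (1 - l) • B) := by
  have h1' : 0 < 1 - l := by linarith
  have h := (hA.const_smul_of_ne_zero h0.ne').volume_add_le_volume_add
    (hB.const_smul_of_ne_zero h1'.ne') hA0.smul_set hB0.smul_set
  rwa [Measure.addHaar_smul, Measure.addHaar_smul, Module.finrank_self, pow_one, pow_one,
    abs_of_pos h0, abs_of_pos h1'] at h

/-- One-dimensional Prékopa-Leindler inequality for functions with supremum one. -/
theorem prekopa_leindler_of_sup_eq_one {l : ℝ} (h0 : 0 < l) (h1 : l < 1) {f g h : ℝ → ℝ}
    (hf : Measurable f) (hg : Measurable g) (hh : Measurable h)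
    (hf0 : ∀ x, 0 ≤ f x) (hg0 : ∀ x, 0 ≤ g x) (hh0 : ∀ x, 0 ≤ h x)
    (hf1 : ∀ x, f x ≤ 1) (hg1 : ∀ x, g x ≤ 1)
    (hfs : ∀ t < 1, ∃ x, t < f x) (hgs : ∀ t < 1, ∃ x, t < g x)
    (hfgh : ∀ x y, f x ^ l * g y ^ (1 - l) ≤ h (l * x + (1 - l) * y)) :
    (∫⁻ x, ENNReal.ofReal (f x)) ^ l * (∫⁻ x, ENNReal.ofReal (g x)) ^ (1 - l) ≤
      ∫⁻ x, ENNReal.ofReal (h x) := by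
  have h1' : 0 < 1 - l := by linarith
  -- With both suprema equal to one, the stronger arithmetic-mean bound holds: for `t < 1` both
  -- superlevel sets are nonempty, so Brunn-Minkowski applies level by level.
  refine (ENNReal.rpow_mul_rpow_le_weighted_add h0 h1 _ _).trans ?_
  have anti : ∀ f : ℝ → ℝ, Measurable fun t : ℝ => volume {a | t < f a} := fun f =>
    Antitone.measurable fun s t hst => measure_mono fun a (ha : t < f a) => hst.trans_lt ha
  rw [lintegral_eq_lintegral_meas_lt _ (.of_forall hf0) hf.aemeasurable,
    lintegral_eq_lintegral_meas_lt _ (.of_forall hg0) hg.aemeasurable,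
    lintegral_eq_lintegral_meas_lt _ (.of_forall hh0) hh.aemeasurable,
    ← lintegral_const_mul _ (anti f), ← lintegral_const_mul _ (anti g),
    ← lintegral_add_left ((anti f).const_mul _)]
  refine setLIntegral_mono (anti h) fun t (ht : 0 < t) => ?_
  rcases lt_or_ge t 1 with ht1 | ht1
  · refine (MeasurableSet.volume_weighted_add_le h0 h1 (measurableSet_lt measurable_const hf)
      (measurableSet_lt measurable_const hg) (hfs t ht1) (hgs t ht1)).trans (measure_mono ?_)
    rintro _ ⟨_, ⟨x, hx, rfl⟩, _, ⟨y, hy, rfl⟩, rfl⟩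
    refine lt_of_lt_of_le ?_ (hfgh x y)
    calc t = t ^ l * t ^ (1 - l) := by rw [← Real.rpow_add ht]; simp
      _ < f x ^ l * g y ^ (1 - l) :=
        mul_lt_mul'' (Real.rpow_lt_rpow ht.le hx h0) (Real.rpow_lt_rpow ht.le hy h1')
          (by positivity) (by positivity)
  · have hfe : {a | t < f a} = ∅ := Set.eq_empty_of_forall_notMem fun a ha =>
      ((hf1 a).trans ht1).not_gt ha
    have hge : {a | t < g a} = ∅ := Set.eq_empty_of_forall_notMem fun a ha =>
      ((hg1 a).trans ht1).not_gt ha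
    simp [hfe, hge]

/-- One-dimensional Prékopa-Leindler inequality for bounded functions. -/
theorem prekopa_leindler_of_bddAbove {l : ℝ} (h0 : 0 < l) (h1 : l < 1) {f g h : ℝ → ℝ}
    (hf : Measurable f) (hg : Measurable g) (hh : Measurable h)
    (hf0 : ∀ x, 0 ≤ f x) (hg0 : ∀ x, 0 ≤ g x) (hh0 : ∀ x, 0 ≤ h x)
    (hfb : BddAbove (Set.range f)) (hgb : BddAbove (Set.range g))
    (hfgh : ∀ x y, f x ^ l * g y ^ (1 - l) ≤ h (l * x + (1 - l) * y)) :
    (∫⁻ x, ENNReal.ofReal (f x)) ^ l * (∫⁻ x, ENNReal.ofReal (g x)) ^ (1 - l) ≤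
      ∫⁻ x, ENNReal.ofReal (h x) := by
  have h1' : 0 < 1 - l := by linarith
  have zero : ∀ f : ℝ → ℝ, BddAbove (Set.range f) → ¬ 0 < (⨆ x, f x) →
      ∫⁻ x, ENNReal.ofReal (f x) = 0 := fun f hb hs => by
    have : ∀ x, ENNReal.ofReal (f x) = 0 := fun x =>
      ENNReal.ofReal_of_nonpos ((le_ciSup hb x).trans (not_lt.1 hs))
    simp [this]
  by_cases ha : 0 < ⨆ x, f x
  swap
  · simp [zero f hfb ha, h0]
  by_cases hb : 0 < ⨆ x, g x
  swap
  · simp [zero g hgb hb, h1]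
  set a := ⨆ x, f x with ha_def
  set b := ⨆ x, g x with hb_def
  have hab : 0 < a ^ l * b ^ (1 - l) := by positivity
  have hsup : ∀ f : ℝ → ℝ, 0 < (⨆ x, f x) → ∀ t < 1, ∃ x, t < f x / ⨆ x, f x := by
    intro f hf t ht
    obtain ⟨x, hx⟩ := exists_lt_of_lt_ciSup
      (show t * (⨆ x, f x) < ⨆ x, f x from mul_lt_of_lt_one_left hf ht)
    exact ⟨x, (lt_div_iff₀ hf).2 hx⟩
  have key := prekopa_leindler_of_sup_eq_one h0 h1 (f := fun x => f x / a) (g := fun x => g x / b)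
    (h := fun x => h x / (a ^ l * b ^ (1 - l))) (hf.div_const _) (hg.div_const _) (hh.div_const _)
    (fun x => div_nonneg (hf0 x) ha.le) (fun x => div_nonneg (hg0 x) hb.le)
    (fun x => div_nonneg (hh0 x) hab.le) (fun x => (div_le_one ha).2 (le_ciSup hfb x))
    (fun x => (div_le_one hb).2 (le_ciSup hgb x)) (hsup f ha) (hsup g hb) (fun x y => by
      rw [Real.div_rpow (hf0 x) ha.le, Real.div_rpow (hg0 y) hb.le, div_mul_div_comm]
      exact div_le_div_of_nonneg_right (hfgh x y) hab.le)
  have scale : ∀ (f : ℝ → ℝ) (c : ℝ), Measurable f → 0 < c → ∫⁻ x, ENNReal.ofReal (f x) =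
      ENNReal.ofReal c * ∫⁻ x, ENNReal.ofReal (f x / c) := by
    intro f c hf hc
    rw [← lintegral_const_mul _ (hf.div_const c).ennreal_ofReal]
    refine lintegral_congr fun x => ?_
    rw [← ENNReal.ofReal_mul hc.le, mul_div_cancel₀ _ hc.ne']
  rw [scale f a hf ha, scale g b hg hb, scale h _ hh hab,
    ENNReal.mul_rpow_of_nonneg _ _ h0.le, ENNReal.mul_rpow_of_nonneg _ _ h1'.le,
    mul_mul_mul_comm, ENNReal.ofReal_rpow_of_pos ha, ENNReal.ofReal_rpow_of_pos hb,
    ← ENNReal.ofReal_mul (by positivity)]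
  gcongr

/-! ### Log-concave measures: products and linear images. -/

/-- The log-concavity inequality of a measure for measurable sets and weights in `(0, 1)`. -/
def IsLogConcave {E : Type*} [AddCommGroup E] [Module ℝ E] [MeasurableSpace E]
    (μ : Measure E) : Prop :=
  ∀ l : ℝ, 0 < l → l < 1 → ∀ A B : Set E, MeasurableSet A → MeasurableSet B →
    μ A ^ l * μ B ^ (1 - l) ≤ μ (l • A + (1 - l) • B)

/-- The substitution `t = exp s` turns geometric means of levels into arithmetic means of `s`, the
form required by Prékopa-Leindler on the line. -/
theorem lintegral_eq_lintegral_exp_mul_meas_lt {E : Type*} [MeasurableSpace E] (μ : Measure E)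
    [IsFiniteMeasure μ] {f : E → ℝ} (hf : Measurable f) (hf0 : ∀ x, 0 ≤ f x) :
    ∫⁻ x, ENNReal.ofReal (f x) ∂μ =
      ∫⁻ s : ℝ, ENNReal.ofReal (Real.exp s * μ.real {x | Real.exp s < f x}) := by
  rw [lintegral_eq_lintegral_meas_lt _ (.of_forall hf0) hf.aemeasurable]
  have h := lintegral_image_eq_lintegral_abs_deriv_mul MeasurableSet.univ
    (fun x _ => (Real.hasDerivAt_exp x).hasDerivWithinAt) Real.exp_injective.injOn
    (fun t => μ {x | t < f x})
  rw [Set.image_univ, Real.range_exp, Measure.restrict_univ] at h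
  rw [h]
  refine lintegral_congr fun s => ?_
  rw [abs_of_pos (Real.exp_pos s), ENNReal.ofReal_mul (Real.exp_pos s).le, ofReal_measureReal]

namespace IsLogConcave

variable {E F : Type*} [AddCommGroup E] [Module ℝ E] [MeasurableSpace E]
  [AddCommGroup F] [Module ℝ F] [MeasurableSpace F]

theorem measureReal_rpow_mul_le {μ : Measure E} [IsFiniteMeasure μ] (hμ : IsLogConcave μ)
    {l : ℝ} (h0 : 0 < l) (h1 : l < 1) {A B C : Set E} (hA : MeasurableSet A)
    (hB : MeasurableSet B) (hC : ∀ x ∈ A, ∀ y ∈ B, l • x + (1 - l) • y ∈ C) :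
    μ.real A ^ l * μ.real B ^ (1 - l) ≤ μ.real C := by
  have h1' : 0 < 1 - l := by linarith
  have hsub : l • A + (1 - l) • B ⊆ C := by
    rintro _ ⟨_, ⟨x, hx, rfl⟩, _, ⟨y, hy, rfl⟩, rfl⟩
    exact hC x hx y hy
  have h := (hμ l h0 h1 A B hA hB).trans (measure_mono hsub)
  have := ENNReal.toReal_mono (measure_ne_top μ C) h
  rwa [ENNReal.toReal_mul, ← ENNReal.toReal_rpow, ← ENNReal.toReal_rpow] at this

/-- The Prékopa-Leindler inequality for a finite log-concave measure. -/
theorem lintegral_rpow_mul_le {μ : Measure E} [IsFiniteMeasure μ] (hμ : IsLogConcave μ)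
    {l : ℝ} (h0 : 0 < l) (h1 : l < 1) {f g h : E → ℝ}
    (hf : Measurable f) (hg : Measurable g) (hh : Measurable h)
    (hf0 : ∀ x, 0 ≤ f x) (hg0 : ∀ x, 0 ≤ g x) (hh0 : ∀ x, 0 ≤ h x)
    (hf1 : ∀ x, f x ≤ 1) (hg1 : ∀ x, g x ≤ 1)
    (hfgh : ∀ x y, f x ^ l * g y ^ (1 - l) ≤ h (l • x + (1 - l) • y)) :
    (∫⁻ x, ENNReal.ofReal (f x) ∂μ) ^ l * (∫⁻ x, ENNReal.ofReal (g x) ∂μ) ^ (1 - l) ≤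
      ∫⁻ x, ENNReal.ofReal (h x) ∂μ := by
  have h1' : 0 < 1 - l := by linarith
  rw [lintegral_eq_lintegral_exp_mul_meas_lt μ hf hf0,
    lintegral_eq_lintegral_exp_mul_meas_lt μ hg hg0,
    lintegral_eq_lintegral_exp_mul_meas_lt μ hh hh0]
  have meas : ∀ f : E → ℝ, Measurable fun s : ℝ => Real.exp s * μ.real {x | Real.exp s < f x} := by
    intro f
    refine Real.measurable_exp.mul (Antitone.measurable fun s t hst => ?_)
    exact measureReal_mono fun x (hx : Real.exp t < f x) =>
      (Real.exp_le_exp.2 hst).trans_lt hx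
  have bdd : ∀ f : E → ℝ, (∀ x, f x ≤ 1) →
      BddAbove (Set.range fun s : ℝ => Real.exp s * μ.real {x | Real.exp s < f x}) := by
    rintro f hf
    refine ⟨μ.real Set.univ, ?_⟩
    rintro _ ⟨s, rfl⟩
    simp only
    rcases lt_or_ge (Real.exp s) 1 with hs | hs
    · calc Real.exp s * μ.real {x | Real.exp s < f x} ≤ 1 * μ.real Set.univ :=
          mul_le_mul hs.le (measureReal_mono (Set.subset_univ _)) measureReal_nonneg zero_le_one
        _ = _ := one_mul _
    · rw [Set.eq_empty_of_forall_notMem (s := {x | Real.exp s < f x}) fun x hx =>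
        ((hf x).trans hs).not_gt hx]
      simp
  refine prekopa_leindler_of_bddAbove h0 h1 (meas f) (meas g) (meas h)
    (fun s => by positivity) (fun s => by positivity) (fun s => by positivity)
    (bdd f hf1) (bdd g hg1) fun s t => ?_
  rw [Real.mul_rpow (Real.exp_pos s).le measureReal_nonneg,
    Real.mul_rpow (Real.exp_pos t).le measureReal_nonneg, mul_mul_mul_comm]
  have hexp : Real.exp s ^ l * Real.exp t ^ (1 - l) = Real.exp (l * s + (1 - l) * t) := by
    rw [← Real.exp_mul, ← Real.exp_mul, ← Real.exp_add, mul_comm s, mul_comm t]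
  rw [hexp]
  refine mul_le_mul_of_nonneg_left ?_ (Real.exp_pos _).le
  refine hμ.measureReal_rpow_mul_le h0 h1 (measurableSet_lt measurable_const hf)
    (measurableSet_lt measurable_const hg) fun x hx y hy => ?_
  rw [Set.mem_ofPred_eq, ← hexp]
  exact (mul_lt_mul'' (Real.rpow_lt_rpow (Real.exp_pos s).le hx h0)
    (Real.rpow_lt_rpow (Real.exp_pos t).le hy h1') (by positivity) (by positivity)).trans_le
    (hfgh x y)

/-- By Fubini, the measures of the sections are the functions to compare: the section of `l • A + (1
- l) • B` over `l • x + (1 - l) • y` contains the combination of the sections of `A` over `x` and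
`B` over `y`. -/
theorem prod {μ : Measure E} {ν : Measure F} [IsProbabilityMeasure μ] [IsProbabilityMeasure ν]
    (hμ : IsLogConcave μ) (hν : IsLogConcave ν) : IsLogConcave (μ.prod ν) := by
  intro l h0 h1 A B hA hB
  -- The combination of measurable sets need not be measurable; a measurable hull of equal measure
  -- replaces it.
  set C := toMeasurable (μ.prod ν) (l • A + (1 - l) • B) with hC_def
  have hC : MeasurableSet C := measurableSet_toMeasurable _ _
  have hsub : l • A + (1 - l) • B ⊆ C := subset_toMeasurable _ _
  have int : ∀ {S : Set (E × F)}, MeasurableSet S →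
      μ.prod ν S = ∫⁻ x, ENNReal.ofReal (ν.real (Prod.mk x ⁻¹' S)) ∂μ := fun hS => by
    rw [Measure.prod_apply hS]
    exact lintegral_congr fun x => by rw [ofReal_measureReal]
  have meas : ∀ {S : Set (E × F)}, MeasurableSet S →
      Measurable fun x => ν.real (Prod.mk x ⁻¹' S) := fun hS =>
    (measurable_measure_prodMk_left hS).ennreal_toReal
  rw [← measure_toMeasurable (l • A + (1 - l) • B), ← hC_def, int hA, int hB, int hC]
  refine hμ.lintegral_rpow_mul_le h0 h1 (meas hA) (meas hB) (meas hC)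
    (fun _ => measureReal_nonneg) (fun _ => measureReal_nonneg) (fun _ => measureReal_nonneg)
    (fun _ => measureReal_le_one) (fun _ => measureReal_le_one) fun x y => ?_
  refine hν.measureReal_rpow_mul_le h0 h1 (measurable_prodMk_left hA)
    (measurable_prodMk_left hB) fun s hs t ht => ?_
  exact hsub ⟨l • (x, s), ⟨_, hs, rfl⟩, (1 - l) • (y, t), ⟨_, ht, rfl⟩, rfl⟩

theorem map {μ : Measure E} (hμ : IsLogConcave μ) (L : E →ₗ[ℝ] F) (hL : Measurable L) :
    IsLogConcave (μ.map L) := by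
  intro l h0 h1 A B hA hB
  rw [← measure_toMeasurable (l • A + (1 - l) • B), Measure.map_apply hL hA,
    Measure.map_apply hL hB, Measure.map_apply hL (measurableSet_toMeasurable _ _)]
  refine (hμ l h0 h1 _ _ (hL hA) (hL hB)).trans (measure_mono ?_)
  rintro _ ⟨_, ⟨x, hx, rfl⟩, _, ⟨y, hy, rfl⟩, rfl⟩
  refine subset_toMeasurable _ _ ?_
  simp only [map_add, map_smul]
  exact Set.add_mem_add (Set.smul_mem_smul_set hx) (Set.smul_mem_smul_set hy)

theorem dirac_zero : IsLogConcave (Measure.dirac (0 : E)) := by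
  intro l h0 h1 A B hA hB
  have h1' : 0 < 1 - l := by linarith
  by_cases h : (0 : E) ∈ A ∧ (0 : E) ∈ B
  · have : (0 : E) ∈ l • A + (1 - l) • B :=
      ⟨0, ⟨0, h.1, by simp⟩, 0, ⟨0, h.2, by simp⟩, by simp⟩
    rw [Measure.dirac_apply_of_mem h.1, Measure.dirac_apply_of_mem h.2,
      Measure.dirac_apply_of_mem this]
    simp
  · rw [Measure.dirac_apply' _ hA, Measure.dirac_apply' _ hB]
    rcases not_and_or.1 h with h | h <;> simp [h, h0, h1]

end IsLogConcave

/-! ### Stability under almost sure limits. -/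

theorem ENNReal.rpow_mul_rpow_le_of_tendsto_zero {l : ℝ} (h0 : 0 < l) (h1 : l < 1)
    {a b c : ℝ≥0∞} (ha : a ≠ ∞) (hb : b ≠ ∞) {d : ℕ → ℝ≥0∞} (hd : Tendsto d atTop (𝓝 0))
    (h : ∀ n, (a - d n) ^ l * (b - d n) ^ (1 - l) ≤ c + d n) : a ^ l * b ^ (1 - l) ≤ c := by
  have h1' : 0 < 1 - l := by linarith
  have sub : ∀ a : ℝ≥0∞, a ≠ ∞ → Tendsto (fun n => a - d n) atTop (𝓝 a) := fun a ha => by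
    simpa using ENNReal.Tendsto.sub (tendsto_const_nhds (x := a)) hd (Or.inl ha)
  refine le_of_tendsto_of_tendsto' (ENNReal.Tendsto.mul
    ((ENNReal.continuous_rpow_const.tendsto a).comp (sub a ha)) (Or.inr ?_)
    ((ENNReal.continuous_rpow_const.tendsto b).comp (sub b hb)) (Or.inr ?_))
    (by simpa using tendsto_const_nhds.add hd) h
  · exact ENNReal.rpow_ne_top_of_nonneg h1'.le hb
  · exact ENNReal.rpow_ne_top_of_nonneg h0.le ha

theorem MeasureTheory.exists_measureReal_norm_gt_le {X : Type*} [NormedAddCommGroup X] [MeasurableSpace X]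
    [BorelSpace X] (μ : Measure X) [IsFiniteMeasure μ] {c : ℝ} (hc : 0 < c) :
    ∃ r : ℝ, 0 < r ∧ μ.real {x | r < ‖x‖} ≤ c := by
  have h := tendsto_measure_iInter_atTop (μ := μ) (s := fun n : ℕ => {x : X | (n : ℝ) < ‖x‖})
    (fun n => (isOpen_lt continuous_const continuous_norm).measurableSet.nullMeasurableSet)
    (fun m n hmn x (hx : (n : ℝ) < ‖x‖) => (Nat.cast_le.2 hmn).trans_lt hx)
    ⟨0, measure_ne_top _ _⟩
  have he : ⋂ n : ℕ, {x : X | (n : ℝ) < ‖x‖} = ∅ := by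
    refine Set.eq_empty_of_forall_notMem fun x hx => ?_
    obtain ⟨n, hn⟩ := exists_nat_ge ‖x‖
    exact hn.not_gt (Set.mem_iInter.1 hx n)
  rw [he, measure_empty] at h
  obtain ⟨n, hn, hn0⟩ :=
    ((h.eventually_lt_const (ENNReal.ofReal_pos.2 hc)).and (eventually_gt_atTop 0)).exists
  exact ⟨n, Nat.cast_pos.2 hn0, ENNReal.toReal_le_of_le_ofReal hc.le hn.le⟩

namespace IsLogConcave

section Limit

variable {X : Type*} [NormedAddCommGroup X] [NormedSpace ℝ X] [MeasurableSpace X]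

/-- For compact sets the combination is again compact, hence the limit of its closed thickenings;
this is what the passage to the limit needs. -/
theorem of_isCompact {μ : Measure X} [IsFiniteMeasure μ] [μ.InnerRegular]
    (h : ∀ l : ℝ, 0 < l → l < 1 → ∀ K L : Set X, IsCompact K → IsCompact L →
      μ K ^ l * μ L ^ (1 - l) ≤ μ (l • K + (1 - l) • L)) : IsLogConcave μ := by
  intro l h0 h1 A B hA hB
  have h1' : 0 < 1 - l := by linarith
  refine ENNReal.rpow_mul_rpow_le_of_tendsto_zero h0 h1 (measure_ne_top μ A) (measure_ne_top μ B)
    ENNReal.tendsto_inv_nat_nhds_zero fun n => ?_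
  have hn : (n : ℝ≥0∞)⁻¹ ≠ 0 := ENNReal.inv_ne_zero.2 (ENNReal.natCast_ne_top n)
  obtain ⟨K, hKA, hK, hAK⟩ := hA.exists_isCompact_lt_add (measure_ne_top μ A) hn
  obtain ⟨L, hLB, hL, hBL⟩ := hB.exists_isCompact_lt_add (measure_ne_top μ B) hn
  calc _ ≤ μ K ^ l * μ L ^ (1 - l) := by
        gcongr <;> rw [tsub_le_iff_right]
        exacts [hAK.le, hBL.le]
    _ ≤ μ (l • K + (1 - l) • L) := h l h0 h1 K L hK hL
    _ ≤ μ (l • A + (1 - l) • B) :=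
        measure_mono (Set.add_subset_add (Set.smul_set_mono hKA) (Set.smul_set_mono hLB))
    _ ≤ _ := le_self_add

variable [BorelSpace X] {Ω : Type*} [MeasurableSpace Ω] {P : Measure Ω}

/-- Off an event of probability `d n → 0`, `S n` and `T` are within `δ`. One `δ` is lost in passing
from `T` to `S n` and another in returning, hence the radius `2 * δ`, which finally shrinks to zero.
-/
theorem map_of_tendsto_ae [IsFiniteMeasure P] [SecondCountableTopology X] {S : ℕ → Ω → X} {T : Ω → X}
    (hS : ∀ n, Measurable (S n)) (hT : AEMeasurable T P) [(P.map T).InnerRegular]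
    (hlim : ∀ᵐ ω ∂P, Tendsto (fun n => S n ω) atTop (𝓝 (T ω)))
    (hconc : ∀ n, IsLogConcave (P.map (S n))) : IsLogConcave (P.map T) := by
  refine of_isCompact fun l h0 h1 K L hK hL => ?_
  have h1' : 0 < 1 - l := by linarith
  set M := l • K + (1 - l) • L with hM_def
  have hM : IsCompact M := (hK.smul l).add (hL.smul (1 - l))
  have hconv := tendstoInMeasure_of_tendsto_ae (fun n => (hS n).aestronglyMeasurable) hlim
  have step : ∀ δ : ℝ, 0 < δ → P.map T K ^ l * P.map T L ^ (1 - l) ≤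
      P.map T (Metric.cthickening (2 * δ) M) := by
    intro δ hδ
    set d : ℕ → ℝ≥0∞ := fun n => P {ω | ENNReal.ofReal δ ≤ edist (S n ω) (T ω)} with hd_def
    refine ENNReal.rpow_mul_rpow_le_of_tendsto_zero h0 h1 (measure_ne_top _ _)
      (measure_ne_top _ _) (hconv _ (ENNReal.ofReal_pos.2 hδ)) fun n => ?_
    have hdist : ∀ ω, ω ∉ {ω | ENNReal.ofReal δ ≤ edist (S n ω) (T ω)} →
        dist (S n ω) (T ω) < δ := fun ω hω => by
      have : edist (S n ω) (T ω) < ENNReal.ofReal δ := not_le.1 hω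
      rwa [edist_dist, ENNReal.ofReal_lt_ofReal_iff hδ] at this
    have lower : ∀ K : Set X, IsCompact K →
        P.map T K - d n ≤ P.map (S n) (Metric.thickening δ K) := by
      intro K hK
      rw [tsub_le_iff_right, Measure.map_apply_of_aemeasurable hT hK.measurableSet,
        Measure.map_apply (hS n) Metric.isOpen_thickening.measurableSet]
      refine (measure_mono fun ω hω => ?_).trans (measure_union_le _ _)
      by_cases h : ω ∈ {ω | ENNReal.ofReal δ ≤ edist (S n ω) (T ω)}
      · exact Or.inr h
      · exact Or.inl (Metric.mem_thickening_iff.2 ⟨T ω, hω, hdist ω h⟩)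
    have mid : l • Metric.thickening δ K + (1 - l) • Metric.thickening δ L ⊆
        Metric.thickening δ M := by
      rintro _ ⟨_, ⟨x, hx, rfl⟩, _, ⟨y, hy, rfl⟩, rfl⟩
      obtain ⟨k, hk, hxk⟩ := Metric.mem_thickening_iff.1 hx
      obtain ⟨m, hm, hym⟩ := Metric.mem_thickening_iff.1 hy
      refine Metric.mem_thickening_iff.2 ⟨l • k + (1 - l) • m,
        Set.add_mem_add (Set.smul_mem_smul_set hk) (Set.smul_mem_smul_set hm), ?_⟩
      refine (dist_add_add_le _ _ _ _).trans_lt ?_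
      rw [dist_smul₀, dist_smul₀, Real.norm_of_nonneg h0.le, Real.norm_of_nonneg h1'.le]
      nlinarith
    have upper : P.map (S n) (Metric.thickening δ M) ≤
        P.map T (Metric.cthickening (2 * δ) M) + d n := by
      rw [Measure.map_apply_of_aemeasurable hT Metric.isClosed_cthickening.measurableSet,
        Measure.map_apply (hS n) Metric.isOpen_thickening.measurableSet]
      refine (measure_mono fun ω hω => ?_).trans (measure_union_le _ _)
      by_cases h : ω ∈ {ω | ENNReal.ofReal δ ≤ edist (S n ω) (T ω)}
      · exact Or.inr h
      · refine Or.inl (Metric.thickening_subset_cthickening _ _ ?_)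
        obtain ⟨m, hm, hd⟩ := Metric.mem_thickening_iff.1 hω
        refine Metric.mem_thickening_iff.2 ⟨m, hm, ?_⟩
        have h2 := dist_triangle_left (T ω) m (S n ω)
        linarith [hdist ω h]
    calc _ ≤ P.map (S n) (Metric.thickening δ K) ^ l *
          P.map (S n) (Metric.thickening δ L) ^ (1 - l) := by
          gcongr
          exacts [lower K hK, lower L hL]
      _ ≤ _ := hconc n l h0 h1 _ _ Metric.isOpen_thickening.measurableSet
          Metric.isOpen_thickening.measurableSet
      _ ≤ _ := measure_mono mid
      _ ≤ _ := upper
  have hlim' : Tendsto (fun r => P.map T (Metric.cthickening r M)) (𝓝[>] 0) (𝓝 (P.map T M)) :=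
    (tendsto_measure_cthickening_of_isClosed ⟨1, one_pos, measure_ne_top _ _⟩
      hM.isClosed).mono_left nhdsWithin_le_nhds
  refine ge_of_tendsto hlim' (eventually_nhdsWithin_of_forall fun r (hr : 0 < r) => ?_)
  simpa [mul_div_cancel₀] using step (r / 2) (half_pos hr)

theorem map_sum_smul [SecondCountableTopology X] [IsProbabilityMeasure P] {ξ : ℕ → Ω → ℝ}
    (hξ_meas : ∀ k, Measurable (ξ k))
    (hξ_indep : iIndepFun ξ P) (hξ : ∀ k, IsLogConcave (P.map (ξ k))) (v : ℕ → X) (n : ℕ) :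
    IsLogConcave (P.map fun ω => ∑ k ∈ Finset.range n, ξ k ω • v k) := by
  induction n with
  | zero =>
    simp only [Finset.range_zero, Finset.sum_empty, Measure.map_const, measure_univ, one_smul]
    exact dirac_zero
  | succ n ih =>
    have hS : Measurable fun ω => ∑ k ∈ Finset.range n, ξ k ω • v k :=
      Finset.measurable_fun_sum _ fun k _ => (hξ_meas k).smul_const (v k)
    have hind : IndepFun (fun ω => ∑ k ∈ Finset.range n, ξ k ω • v k) (ξ n) P := by
      have h := hξ_indep.indepFun_finset (Finset.range n) {n} (by simp) hξ_meas
      have hφ : Measurable fun z : Finset.range n → ℝ => ∑ k, z k • v k :=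
        Finset.measurable_fun_sum _ fun k _ => (measurable_pi_apply k).smul_const (v k)
      have hψ : Measurable fun z : ({n} : Finset ℕ) → ℝ => z ⟨n, Finset.mem_singleton_self n⟩ :=
        measurable_pi_apply _
      have h2 : IndepFun _ (ξ n) P := h.comp hφ hψ
      convert h2 using 1
      ext ω
      exact (Finset.sum_coe_sort (Finset.range n) (fun k => ξ k ω • v k)).symm
    have : IsProbabilityMeasure (P.map fun ω => ∑ k ∈ Finset.range n, ξ k ω • v k) :=
      Measure.isProbabilityMeasure_map hS.aemeasurable
    have : IsProbabilityMeasure (P.map (ξ n)) :=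
      Measure.isProbabilityMeasure_map (hξ_meas n).aemeasurable
    have hL : Measurable ((LinearMap.fst ℝ X ℝ) + (LinearMap.snd ℝ X ℝ).smulRight (v n)) :=
      measurable_fst.add (measurable_snd.smul_const (v n))
    have h := (ih.prod (hξ n)).map _ hL
    rw [← hind.map_prod_eq_prod_map_map hS.aemeasurable (hξ_meas n).aemeasurable,
      Measure.map_map hL (hS.prodMk (hξ_meas n))] at h
    convert h using 2
    ext ω
    simp [Finset.sum_range_succ]

end Limit

/-! ### Borell's tail estimate and exponential moments. -/

section Tails

variable {X : Type*} [NormedAddCommGroup X] [NormedSpace ℝ X] [MeasurableSpace X] [BorelSpace X]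
  {μ : Measure X}

theorem measureReal_norm_gt_le [IsProbabilityMeasure μ] (hμ : IsLogConcave μ) {r : ℝ}
    (hr : μ.real {x | r < ‖x‖} ≤ 1 / 5) (n : ℕ) :
    μ.real {x | n * r < ‖x‖} ≤ (1 / 2) ^ n := by
  have meas : ∀ c : ℝ, MeasurableSet {x : X | c < ‖x‖} := fun c =>
    (isOpen_lt continuous_const continuous_norm).measurableSet
  -- The weight `2 / (m + 1)` used below is less than one only for `m ≥ 2`.
  match n with
  | 0 => simp
  | 1 => simpa using hr.trans (by norm_num)
  | n + 2 =>
    set m : ℕ := n + 2 with hm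
    have hm1 : (2 : ℝ) ≤ m := by rw [hm]; push_cast; linarith [(Nat.cast_nonneg n : (0 : ℝ) ≤ n)]
    have hmp : (0 : ℝ) < m + 1 := by linarith
    -- Chosen so that `l * m - (1 - l) = 1`: combining a point of norm above `m * r` with one of
    -- norm at most `r` gives norm above `r`.
    set l : ℝ := 2 / (m + 1) with hl
    have h0 : 0 < l := by positivity
    have h1 : l < 1 := by rw [hl, div_lt_one hmp]; linarith
    have hlm : l * (m + 1) = 2 := div_mul_cancel₀ _ hmp.ne'
    set q := μ.real {x | m * r < ‖x‖} with hq
    set θ := μ.real {x | r < ‖x‖}ᶜ with hθ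
    have hθ1 : θ = 1 - μ.real {x | r < ‖x‖} := probReal_compl_eq_one_sub (meas r)
    have hθ4 : 4 / 5 ≤ θ := by linarith
    have hθle : θ ≤ 1 := measureReal_le_one
    have key : q ^ l * θ ^ (1 - l) ≤ μ.real {x | r < ‖x‖} := by
      refine hμ.measureReal_rpow_mul_le h0 h1 (meas _) (meas r).compl fun x hx y hy => ?_
      have hx : m * r < ‖x‖ := hx
      have hy : ‖y‖ ≤ r := not_lt.1 hy
      have h2 : l * ‖x‖ - (1 - l) * ‖y‖ ≤ ‖l • x + (1 - l) • y‖ := by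
        have := norm_sub_le_norm_add (l • x) ((1 - l) • y)
        rwa [norm_smul, norm_smul, Real.norm_of_nonneg h0.le,
          Real.norm_of_nonneg (by linarith : 0 ≤ 1 - l)] at this
      have h3 : l * (m * r) < l * ‖x‖ := mul_lt_mul_of_pos_left hx h0
      have h4 : (1 - l) * ‖y‖ ≤ (1 - l) * r := mul_le_mul_of_nonneg_left hy (by linarith)
      have h5 : l * (m * r) - (1 - l) * r = r := by linear_combination r * hlm
      show r < _
      linarith
    have hq0 : 0 ≤ q := measureReal_nonneg
    have hqθ : 4 / 5 ≤ θ ^ (1 - l) :=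
      hθ4.trans (Real.self_le_rpow_of_le_one (by linarith) hθle (by linarith))
    have hql : q ^ l ≤ 1 / 4 := by
      have : 0 ≤ q ^ l := by positivity
      nlinarith
    have hqs : q ≤ (1 / 2) ^ (m + 1) := by
      calc q = (q ^ l) ^ l⁻¹ := (Real.rpow_rpow_inv hq0 h0.ne').symm
        _ ≤ (1 / 4) ^ l⁻¹ := by gcongr
        _ = ((1 / 2 : ℝ) ^ (2 : ℝ)) ^ (((m : ℝ) + 1) / 2) := by
          rw [hl, inv_div]; norm_num
        _ = (1 / 2) ^ (m + 1) := by
          rw [← Real.rpow_mul (by norm_num), mul_div_cancel₀ _ (two_ne_zero)]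
          exact_mod_cast Real.rpow_natCast (1 / 2 : ℝ) (m + 1)
    exact hqs.trans (pow_le_pow_of_le_one (by norm_num) (by norm_num) (Nat.le_succ m))

/-- Borell's theorem: a log-concave probability measure has exponential moments of the norm. -/
theorem exists_integrable_exp_norm [SecondCountableTopology X] [IsProbabilityMeasure μ]
    (hμ : IsLogConcave μ) :
    ∃ ε : ℝ, 0 < ε ∧ Integrable (fun x : X => Real.exp (ε * ‖x‖)) μ := by
  obtain ⟨r, hr0, hr⟩ := exists_measureReal_norm_gt_le μ (show (0 : ℝ) < 1 / 5 by norm_num)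
  have hlog : 0 < Real.log (3 / 2) := Real.log_pos (by norm_num)
  -- Any base in `(1, 2)` would do against tails `(1 / 2) ^ n`; here the ratio is `3 / 4`.
  refine ⟨Real.log (3 / 2) / r, by positivity,
    (by fun_prop : Continuous fun x : X => Real.exp (Real.log (3 / 2) / r * ‖x‖))
      |>.aestronglyMeasurable, ?_⟩
  rw [hasFiniteIntegral_iff_ofReal (.of_forall fun x => (Real.exp_pos _).le)]
  have meas : ∀ c : ℝ, MeasurableSet {x : X | c < ‖x‖} := fun c =>
    (isOpen_lt continuous_const continuous_norm).measurableSet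
  -- The term `n = ⌈‖x‖ / r⌉₊ - 1` alone dominates; the summand `1` covers `x = 0`.
  have bound : ∀ x : X, ENNReal.ofReal (Real.exp (Real.log (3 / 2) / r * ‖x‖)) ≤
      1 + ∑' n : ℕ, {x : X | n * r < ‖x‖}.indicator
        (fun _ => ENNReal.ofReal ((3 / 2) ^ (n + 1))) x := by
    intro x
    have hle : ‖x‖ / r ≤ ⌈‖x‖ / r⌉₊ := Nat.le_ceil _
    have hexp : Real.exp (Real.log (3 / 2) / r * ‖x‖) ≤ (3 / 2) ^ ⌈‖x‖ / r⌉₊ := by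
      rw [← Real.exp_log (show (0 : ℝ) < (3 / 2) ^ ⌈‖x‖ / r⌉₊ by positivity), Real.log_pow,
        Real.exp_le_exp, div_mul_eq_mul_div, mul_div_assoc, mul_comm]
      gcongr
    refine (ENNReal.ofReal_le_ofReal hexp).trans ?_
    rcases hk : ⌈‖x‖ / r⌉₊ with _ | k
    · simp
    · have hx : k * r < ‖x‖ := by
        rw [← lt_div_iff₀ hr0]
        exact Nat.lt_ceil.1 (hk ▸ Nat.lt_succ_self k)
      refine le_add_left (le_trans ?_ (ENNReal.le_tsum k))
      rw [Set.indicator_of_mem (show x ∈ {x : X | k * r < ‖x‖} from hx)]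
  refine (lintegral_mono bound).trans_lt ?_
  rw [lintegral_add_left measurable_const,
    lintegral_tsum fun n => (measurable_const.indicator (meas _)).aemeasurable]
  refine ENNReal.add_lt_top.2 ⟨by simp, ?_⟩
  have hsum : Summable fun n : ℕ => (3 / 2 : ℝ) * (3 / 4) ^ n :=
    (summable_geometric_of_lt_one (by norm_num) (by norm_num)).mul_left _
  refine lt_of_le_of_lt (ENNReal.tsum_le_tsum fun n => ?_) hsum.tsum_ofReal_lt_top
  rw [lintegral_indicator_const (meas _), ← ofReal_measureReal,
    ← ENNReal.ofReal_mul (by positivity)]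
  refine ENNReal.ofReal_le_ofReal ?_
  calc (3 / 2 : ℝ) ^ (n + 1) * μ.real {x | n * r < ‖x‖} ≤ (3 / 2) ^ (n + 1) * (1 / 2) ^ n := by
        gcongr
        exact hμ.measureReal_norm_gt_le hr n
    _ = 3 / 2 * (3 / 4) ^ n := by
        rw [pow_succ', mul_assoc, ← mul_pow]; norm_num

end Tails

end IsLogConcave

/-! ### Convex measures, convergence of the series, and the conclusion. -/

theorem IsConvexMeasure.isLogConcave {X : Type*} [NormedAddCommGroup X] [NormedSpace ℝ X]
    [MeasurableSpace X] [BorelSpace X] {μ : Measure X} (hμ : IsConvexMeasure μ) :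
    IsLogConcave μ := by
  intro l h0 h1 A B hA hB
  have h1' : 0 < 1 - l := by linarith
  rcases A.eq_empty_or_nonempty with rfl | hA0
  · simp [h0]
  rcases B.eq_empty_or_nonempty with rfl | hB0
  · simp [h1]
  exact hμ.convex l h0.le h1.le A B hA hB hA0 hB0

theorem IsLogConcave.isConvexMeasure {X : Type*} [NormedAddCommGroup X] [NormedSpace ℝ X]
    [MeasurableSpace X] [BorelSpace X] {μ : Measure X} [IsLocallyFiniteMeasure μ] [μ.InnerRegular]
    (hμ : IsLogConcave μ) : IsConvexMeasure μ := by
  refine ⟨inferInstance, inferInstance, fun l h0 h1 A B hA hB hA0 hB0 => ?_⟩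
  rcases h0.eq_or_lt with rfl | h0
  -- Nonemptiness gives `0 • A = {0}`, so the combination is `B` itself.
  · simp [Set.zero_smul_set hA0]
  rcases h1.eq_or_lt with rfl | h1
  · simp [Set.zero_smul_set hB0]
  exact hμ l h0 h1 A B hA hB

theorem UnconditionalSchauderBasis.separableSpace {X : Type*} [NormedAddCommGroup X]
    [NormedSpace ℝ X] (x : UnconditionalSchauderBasis ℕ ℝ X) :
    TopologicalSpace.SeparableSpace X := by
  have hsep : TopologicalSpace.IsSeparable
      (closure (Submodule.span ℝ (Set.range x) : Set X)) :=
    ((Set.countable_range x).isSeparable.span (R := ℝ)).closure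
  have huniv : closure (Submodule.span ℝ (Set.range x) : Set X) = Set.univ := by
    refine Set.eq_univ_of_forall fun y => ?_
    refine mem_closure_of_tendsto (x.expansion y).tendsto_sum_nat (.of_forall fun n => ?_)
    exact Submodule.sum_mem _ fun k _ =>
      Submodule.smul_mem _ _ (Submodule.subset_span (Set.mem_range_self k))
  rw [huniv] at hsep
  exact TopologicalSpace.isSeparable_univ_iff.1 hsep

theorem ae_summable_of_summable_integral {Ω : Type*} [MeasurableSpace Ω] {P : Measure Ω}
    {f : ℕ → Ω → ℝ} (hf : ∀ k, Integrable (f k) P) (hf0 : ∀ k ω, 0 ≤ f k ω)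
    (hsum : Summable fun k => ∫ ω, f k ω ∂P) : ∀ᵐ ω ∂P, Summable fun k => f k ω := by
  have hfin : ∫⁻ ω, ∑' k, ENNReal.ofReal (f k ω) ∂P ≠ ∞ := by
    rw [lintegral_tsum fun k => (hf k).aemeasurable.ennreal_ofReal]
    simp_rw [← ofReal_integral_eq_lintegral_ofReal (hf _) (.of_forall (hf0 _))]
    exact hsum.tsum_ofReal_ne_top
  filter_upwards [ae_lt_top' (AEMeasurable.tsum fun k =>
    (hf k).aemeasurable.ennreal_ofReal) hfin] with ω hω
  simpa [ENNReal.toReal_ofReal (hf0 _ _)] using ENNReal.summable_toReal hω.ne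

theorem Summable.of_min_one {a : ℕ → ℝ} (h : Summable fun k => min (a k) 1) : Summable a := by
  have hlt : ∀ᶠ k in cofinite, min (a k) 1 < 1 :=
    h.tendsto_cofinite_zero.eventually_lt_const one_pos
  refine h.congr_cofinite ?_
  filter_upwards [hlt] with k hk
  exact min_eq_left (by by_contra hc; simp [(not_le.1 hc).le] at hk)

theorem mainTheorem12 {X : Type*} [NormedAddCommGroup X] [NormedSpace ℝ X] [CompleteSpace X]
    [MeasurableSpace X] [BorelSpace X]
    (x : UnconditionalSchauderBasis ℕ ℝ X) (hx : ∀ k, ‖x k‖ = 1)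
    {Ω : Type*} [MeasurableSpace Ω] (P : Measure Ω) [IsProbabilityMeasure P]
    (ξ : ℕ → Ω → ℝ) (hξ_meas : ∀ k, Measurable (ξ k)) (hξ_indep : iIndepFun ξ P)
    (hξ_convex : ∀ k, IsConvexMeasure (P.map (ξ k)))
    (γ : ℕ → ℝ)
    (hsum : Summable fun k => ∫ ω, min |γ k * ξ k ω| 1 ∂P) :
    (∀ᵐ ω ∂P, Summable fun k => (γ k * ξ k ω) • x k) ∧
    AEMeasurable (randomSeries x γ ξ) P ∧
    IsProbabilityMeasure (P.map (randomSeries x γ ξ)) ∧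
    IsConvexMeasure (P.map (randomSeries x γ ξ)) ∧
    ∃ ε : ℝ, 0 < ε ∧
      Integrable (fun v : X => Real.exp (ε * ‖v‖)) (P.map (randomSeries x γ ξ)) := by
  have := UnconditionalSchauderBasis.separableSpace x
  have : SecondCountableTopology X := UniformSpace.secondCountable_of_separable X
  have hmin : ∀ k, Integrable (fun ω => min |γ k * ξ k ω| 1) P := fun k =>
    Integrable.of_bound
      (((hξ_meas k).const_mul (γ k)).abs.min measurable_const).aestronglyMeasurable 1
      (.of_forall fun ω => by
        rw [Real.norm_of_nonneg (le_min (abs_nonneg _) zero_le_one)]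
        exact min_le_right _ _)
  have hS : ∀ᵐ ω ∂P, Summable fun k => (γ k * ξ k ω) • x k := by
    filter_upwards [ae_summable_of_summable_integral hmin
      (fun k ω => le_min (abs_nonneg _) zero_le_one) hsum] with ω hω
    refine Summable.of_norm ?_
    simpa [norm_smul, hx] using hω.of_min_one
  -- Moving `γ k` into the vector lets `IsLogConcave.map_sum_smul` apply to the `ξ k` themselves.
  have hmeas : ∀ n, Measurable fun ω => ∑ k ∈ Finset.range n, ξ k ω • γ k • x k := fun n =>
    Finset.measurable_fun_sum _ fun k _ => (hξ_meas k).smul_const _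
  have hlim : ∀ᵐ ω ∂P, Tendsto (fun n => ∑ k ∈ Finset.range n, ξ k ω • γ k • x k) atTop
      (𝓝 (randomSeries x γ ξ ω)) := by
    filter_upwards [hS] with ω hω
    simpa [randomSeries, smul_smul, mul_comm] using hω.hasSum.tendsto_sum_nat
  have hu : AEMeasurable (randomSeries x γ ξ) P :=
    aemeasurable_of_tendsto_metrizable_ae atTop (fun n => (hmeas n).aemeasurable) hlim
  have hprob : IsProbabilityMeasure (P.map (randomSeries x γ ξ)) :=
    Measure.isProbabilityMeasure_map hu
  have hconc : IsLogConcave (P.map (randomSeries x γ ξ)) :=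
    IsLogConcave.map_of_tendsto_ae hmeas hu hlim fun n =>
      IsLogConcave.map_sum_smul hξ_meas hξ_indep (fun k => (hξ_convex k).isLogConcave) _ n
  exact ⟨hS, hu, hprob, hconc.isConvexMeasure, hconc.exists_integrable_exp_norm⟩
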